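/- \textbf{Setting.} Let $(M,\omega)$ be a symplectic surface which is either diffeomorphic to $\mathbb R^2$ or closed and connected of genus $g\ge 1$. Let $\varphi$ be a symplectomorphism of $(M,\omega)$ with a hyperbolic fixed point $x$. Assume that the stable and unstable manifolds $$W^s=\{p\mid \lim_{n\to\infty}\varphi^{n}(p)=x\},\qquad W^u=\{p\mid \lim_{n\to\infty}\varphi^{-n}(p)=x\}$$ (which are injectively immersed lines) intersect transversely, and that $\varphi$ preserves the orientations of $W^s$ and of $W^u$. Fix an orientation of $W^u$, given by an unstable eigenvector of $D\varphi(x)$. For $i\in\{s,u\}$ let $[p,q]_i$ be the segment of $W^i$ between $p$ and $q$. A point $p\in W^s\cap W^u$ is a \emph{contractible homoclinic point} if the loop from $x$ through $[x,p]_u$ to $p$ and back through $[p,x]_s$ is null-homotopic in $M$; $x$ itself is included. Such a point has the Maslov grading $\mu(p)=\mu(p,x)\in\mathbb Z$, where $\mu(p,q)$ is twice the winding number, in an oriented trivialization of $TM$ over a disc bounded by $[p,q]_u\cup[p,q]_s$, of the following loop of tangent lines: it follows the tangent of $[p,q]_u$ from $p$ to $q$, turns counterclockwise at $q$ by an angle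 in $(0,\pi)$ to the tangent of $W^s$, follows the tangent of $[p,q]_s$ back to $p$, and turns clockwise at $p$ by an angle in $(0,\pi)$ to the tangent of $W^u$. For contractible homoclinic points $p,q$ with $\mu(p)-\mu(q)=1$ consider the smooth orientation preserving immersions (up to the boundary and the vertices) of the di-gon, a closed lens in $\mathbb R^2$ with two convex vertices $(\pm1,0)$, which map the lower boundary arc into $W^u$, the upper one into $W^s$, $(-1,0)$ to $p$ and $(1,0)$ to $q$. Put $n(p,q)=0$ if there is none; otherwise put $n(p,q)=+1$ if the direction from $p$ to $q$ along $W^u$ agrees with the orientation of $W^u$, and $n(p,q)=-1$ if it does not. For a finite set $E$ of contractible homoclinic points and $k\in\mathbb Z$ let $E_k=\{p\in E\mid\mu(p)=k\}$, let $C_k(E)=\mathbb Z E_k$ be the free abelian group on $E_k$, and let $$\partial^E_k:C_k(E)\to C_{k-1}(E),\qquad \partial^E_k p=\sum_{q\in E_{k-1}}n(p,q)\,q .$$ $E$ is \emph{$\partial$-complete} if $\partial^E_{k-1}\circ\partial^E_k=0$ for all $k$; then $H_k(E)=\ker\partial^E_k/\operatorname{Img}\partial^E_{k+1}$ and $H(E)=\bigoplus_{k}H_k(E)$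 is its local homoclinic Floer homology. A set $\tilde{\mathcal E}$ of $\partial$-complete finite sets is \emph{chain compatible} if for all $D\subseteq E$ in $\tilde{\mathcal E}$ the inclusion $\mathbb Z D\to\mathbb Z E$ is a chain map. \textbf{Theorem.} Let $\tilde{\mathcal E}$ be chain compatible, partially ordered by inclusion. (1) For all $k\in\mathbb Z$ the groups $H_k(D)$, $D\in\tilde{\mathcal E}$, with the maps induced by the inclusions $D\subseteq E$, form a direct system of $\mathbb Z$-modules over $\tilde{\mathcal E}$. So do the groups $\ker\partial_k^D$, the groups $\operatorname{Img}\partial_{k+1}^D$, and the graded modules $H(D)$, whose transition maps preserve the grading. The systems of the $H_k(D)$ and of the $H(D)$ have direct limits in the category of $\mathbb Z$-modules. (2) Assume moreover that $\tilde{\mathcal E}$ is directed. Then direct limits over $\tilde{\mathcal E}$ are compatible with short exact sequences: a sequence of direct systems of $\mathbb Z$-modules over $\tilde{\mathcal E}$ that is short exact at every index has a short exact sequence of direct limits. In particular, for all $k$ the sequence $$0\to\varinjlim\operatorname{Img}\partial_{k+1}\to\varinjlim\ker\partial_k\to\varinjlim H_k\to0$$ is exact, and so is the corresponding sequence of the direct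 limits of the total modules (the direct sums over all $k$). Consequently $$\varinjlim H_k\;\cong\;\varinjlim\ker\partial_k\,\big/\,\varinjlim\operatorname{Img}\partial_{k+1},$$ compatibly with the projections from $\varinjlim\ker\partial_k$. With $H_k(\tilde{\mathcal E}):=\varinjlim H_k$, the homology $$H(\tilde{\mathcal E}):=\bigoplus_{k\in\mathbb Z}H_k(\tilde{\mathcal E})$$ is well defined: with the canonical degreewise maps $H(D)\to H(\tilde{\mathcal E})$ it is a direct limit of the system of the $H(D)$. -/

import Mathlib

open scoped Manifold ContDiff

noncomputable section

namespace HomoclinicFloer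

open scoped Topology unitInterval

universe u v w w'

/-! ## Direct systems of abelian groups and their direct limits -/

/-- A family of `ℤ`-modules indexed by a preorder, with one linear map for every comparable pair.
It is a direct system if the two laws in `IsDirectSystem` hold. -/
structure SystemData (ι : Type v) [Preorder ι] where
  obj : ι → Type w
  [group : ∀ i, AddCommGroup (obj i)]
  map : ∀ i j : ι, i ≤ j → obj i →ₗ[ℤ] obj j

attribute [instance] SystemData.group

namespace SystemData

variable {ι : Type v} [Preorder ι]

/-- The laws of a direct system: identities and compositions. -/
def IsDirectSystem (A : SystemData.{v, w} ι) : Prop :=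
  (∀ i (h : i ≤ i), A.map i i h = LinearMap.id) ∧
  ∀ i j k (hij : i ≤ j) (hjk : j ≤ k),
    A.map j k hjk ∘ₗ A.map i j hij = A.map i k (hij.trans hjk)

/-- The property of being a direct limit (colimit) of `A`, tested against all `ℤ`-modules in the
universe `w'`. -/
def IsDirectLimit (A : SystemData.{v, w} ι) (L : Type*) [AddCommGroup L]
    (c : ∀ i, A.obj i →ₗ[ℤ] L) : Prop :=
  (∀ i j (h : i ≤ j), c j ∘ₗ A.map i j h = c i) ∧
  ∀ (T : Type w') [AddCommGroup T] (g : ∀ i, A.obj i →ₗ[ℤ] T),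
    (∀ i j (h : i ≤ j), g j ∘ₗ A.map i j h = g i) →
      ∃! θ : L →ₗ[ℤ] T, ∀ i, θ ∘ₗ c i = g i

open Classical in
/-- The direct limit: the direct sum of all `A.obj i` modulo `x ∼ A.map i j h x`. -/
def lim (A : SystemData.{v, w} ι) : Type (max v w) :=
  Module.DirectLimit A.obj A.map

open Classical in
instance (A : SystemData.{v, w} ι) : AddCommGroup A.lim :=
  inferInstanceAs (AddCommGroup (Module.DirectLimit A.obj A.map))

open Classical in
/-- The canonical map of a member of the system to the direct limit. -/
def toLim (A : SystemData.{v, w} ι) (i : ι) : A.obj i →ₗ[ℤ] A.lim :=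
  Module.DirectLimit.of ℤ ι A.obj A.map i

/-- Morphisms of direct systems. -/
structure Hom (A : SystemData.{v, w} ι) (B : SystemData.{v, w'} ι) where
  app : ∀ i, A.obj i →ₗ[ℤ] B.obj i
  comm : ∀ i j (h : i ≤ j), app j ∘ₗ A.map i j h = B.map i j h ∘ₗ app i

open Classical in
/-- The map on direct limits induced by a morphism of direct systems. -/
def Hom.lim {A : SystemData.{v, w} ι} {B : SystemData.{v, w'} ι} (g : Hom A B) :
    A.lim →ₗ[ℤ] B.lim :=
  Module.DirectLimit.map g.app g.comm

/-- Exactness of `0 → A → B → C → 0`. -/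
def IsShortExact {A B C : Type*} [AddCommGroup A] [AddCommGroup B] [AddCommGroup C]
    (g : A →ₗ[ℤ] B) (h : B →ₗ[ℤ] C) : Prop :=
  Function.Injective g ∧ LinearMap.range g = LinearMap.ker h ∧ Function.Surjective h

/-- Passing to direct limits over `ι` is compatible with short exact sequences: a sequence
of direct systems of `ℤ`-modules over `ι` that is short exact at every index has a short exact
sequence of direct limits. -/
def LimitsPreserveShortExact (ι : Type v) [Preorder ι] : Prop :=
  ∀ (A B C : SystemData.{v, w} ι) (g : Hom A B) (h : Hom B C),
    A.IsDirectSystem → B.IsDirectSystem → C.IsDirectSystem →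
    (∀ i, IsShortExact (g.app i) (h.app i)) → IsShortExact g.lim h.lim

/-- The direct sum of a family of systems, with the degreewise transition maps. -/
def directSum {K : Type} (A : K → SystemData.{v, w} ι) : SystemData.{v, w} ι where
  obj i := DirectSum K fun k => (A k).obj i
  map i j h := DirectSum.lmap fun k => (A k).map i j h

/-- The direct sum of a family of morphisms. -/
def Hom.directSum {K : Type} {A B : K → SystemData.{v, w} ι} (g : ∀ k, Hom (A k) (B k)) :
    Hom (SystemData.directSum A) (SystemData.directSum B) where
  app i := DirectSum.lmap fun k => (g k).app i
  comm i j h := by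
    refine LinearMap.ext fun x => DFinsupp.ext fun k => ?_
    exact LinearMap.congr_fun ((g k).comm i j h) ((show DirectSum K fun k => (A k).obj i from x) k)

end SystemData

/-! ## Symplectic surfaces and invariant manifolds of a hyperbolic fixed point -/

/-- The model plane. Every tangent space of a surface `M` is a copy of it: a vector at `y : M` is
given by its coordinates in the preferred chart at `y`. -/
abbrev Plane : Type := EuclideanSpace ℝ (Fin 2)

section Surface

variable {M : Type u} [TopologicalSpace M] [ChartedSpace Plane M]

/-- The velocity `γ'(t)` of a curve. -/
def velocity (γ : ℝ → M) (t : ℝ) : Plane := mfderiv 𝓘(ℝ, ℝ) (𝓡 2) γ t (1 : ℝ)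

/-- The differential of `f` at `y`, as a map of the model plane. -/
def differential (f : M → M) (y : M) : Plane →L[ℝ] Plane := mfderiv (𝓡 2) (𝓡 2) f y

/-- The stable set of `x` under `f`. The unstable set is the stable set under the inverse. -/
def stableSet (f : M → M) (x : M) : Set M :=
  {p | Filter.Tendsto (fun n : ℕ => f^[n] p) Filter.atTop (𝓝 x)}

/-- `γ` is a parametrization of the stable manifold of `x` as an injectively immersed line. The
last condition says that `f` acts on the parameter line as a contraction to `0`; it makes
the topology induced by `γ` the intrinsic topology of the stable manifold. -/
structure IsStableParametrization (f : M → M) (x : M) (γ : ℝ → M) : Prop where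
  smooth : ContMDiff 𝓘(ℝ, ℝ) (𝓡 2) ∞ γ
  immersion : ∀ t, velocity γ t ≠ 0
  injective : Function.Injective γ
  range_eq : Set.range γ = stableSet f x
  zero : γ 0 = x
  contraction : ∃ h : ℝ → ℝ, Continuous h ∧ (∀ t, f (γ t) = γ (h t)) ∧
    ∀ t, Filter.Tendsto (fun n : ℕ => h^[n] t) Filter.atTop (𝓝 0)

/-- The path `c` runs monotonically through the segment of the parametrized curve `γ` between its
end points, namely from `γ a` to `γ b`. -/
def RunsAlong (γ : ℝ → M) (a b : ℝ) {p q : M} (c : Path p q) : Prop :=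
  ∀ t : I, c t = γ (AffineMap.lineMap a b (t : ℝ))

variable (M) in
/-- `M` is the plane, or a closed connected surface of genus `g ≥ 1` (the first homology group, the
abelianized fundamental group, is free of rank `2 g`). -/
def IsPlaneOrClosedOfPositiveGenus : Prop :=
  Nonempty (M ≃ₘ⟮𝓡 2, 𝓡 2⟯ Plane) ∨
  (CompactSpace M ∧ ConnectedSpace M ∧ ∃ g : ℕ, 1 ≤ g ∧ ∀ y : M,
    Nonempty (Additive (Abelianization (FundamentalGroup M y)) ≃+ (Fin (2 * g) → ℤ)))

variable (M) in
/-- A symplectic form on a surface: a smooth nondegenerate alternating form (it is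
closed because `M` has dimension two). -/
structure SymplecticForm [IsManifold (𝓡 2) ∞ M] where
  form : ∀ y : M, TangentSpace (𝓡 2) y →L[ℝ] TangentSpace (𝓡 2) y →L[ℝ] ℝ
  alternating : ∀ y a, form y a a = 0
  nondegenerate : ∀ y a, a ≠ 0 → ∃ b, form y a b ≠ 0
  smooth : ContMDiff (𝓡 2) ((𝓡 2).prod 𝓘(ℝ, Plane →L[ℝ] Plane →L[ℝ] ℝ)) ∞
    (fun y => Bundle.TotalSpace.mk' (Plane →L[ℝ] Plane →L[ℝ] ℝ)
      (E := fun y : M => TangentSpace (𝓡 2) y →L[ℝ] TangentSpace (𝓡 2) y →L[ℝ] ℝ) y (form y))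

end Surface

/-- The setting: a symplectic surface `M` which is the plane or closed of positive genus, and a
symplectomorphism `φ` with a hyperbolic fixed point `x` whose stable and unstable
manifolds intersect transversely; `φ` preserves their orientations; the unstable manifold is
oriented by an unstable eigenvector at `x`. -/
structure Tangle (M : Type u) [TopologicalSpace M] [ChartedSpace Plane M]
    [IsManifold (𝓡 2) ∞ M] where
  surface : IsPlaneOrClosedOfPositiveGenus M
  area : SymplecticForm M
  φ : M ≃ₘ⟮𝓡 2, 𝓡 2⟯ M
  symplectic : ∀ (y : M) (a b : TangentSpace (𝓡 2) y),
    area.form (φ y) (mfderiv (𝓡 2) (𝓡 2) φ y a) (mfderiv (𝓡 2) (𝓡 2) φ y b) = area.form y a b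
  x : M
  fixed : φ x = x
  /-- No complex eigenvalue of the differential at `x` lies on the unit circle. -/
  hyperbolic : ∀ z : ℂ,
    Polynomial.aeval z (differential φ x : Plane →ₗ[ℝ] Plane).charpoly = 0 → ‖z‖ ≠ 1
  transverse : ∀ γs γu : ℝ → M, IsStableParametrization φ x γs →
    IsStableParametrization φ.symm x γu → ∀ a b : ℝ, γs a = γu b →
      LinearIndependent ℝ ![velocity γs a, velocity γu b]
  preserves_orientation : ∀ γ : ℝ → M,
    IsStableParametrization φ x γ ∨ IsStableParametrization φ.symm x γ →
      ∃ h : ℝ → ℝ, StrictMono h ∧ ∀ t, φ (γ t) = γ (h t)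
  /-- The positive direction of the unstable manifold at `x`. -/
  direction : Plane
  direction_ne_zero : direction ≠ 0
  direction_unstable : ∃ l : ℝ, 1 < |l| ∧ differential φ x direction = l • direction

namespace Tangle

variable {M : Type u} [TopologicalSpace M] [ChartedSpace Plane M] [IsManifold (𝓡 2) ∞ M]
  (S : Tangle M)

/-- The stable manifold `W^s`. -/
def stable : Set M := stableSet S.φ S.x

/-- The unstable manifold `W^u`. -/
def unstable : Set M := stableSet S.φ.symm S.x

def IsStableParam (γ : ℝ → M) : Prop := IsStableParametrization S.φ S.x γ

def IsUnstableParam (γ : ℝ → M) : Prop := IsStableParametrization S.φ.symm S.x γ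

/-- `γ` parametrizes the unstable manifold compatibly with its orientation. -/
def IsOrientedUnstableParam (γ : ℝ → M) : Prop :=
  S.IsUnstableParam γ ∧ ∃ c : ℝ, 0 < c ∧ velocity γ 0 = c • S.direction

/-- The homoclinic points, including `x` itself. -/
def homoclinic : Set M := S.stable ∩ S.unstable

/-- The contractible homoclinic points: the loop that runs from `x` to `p` through the unstable
manifold and back to `x` through the stable manifold is null-homotopic. -/
def contractible : Set M :=
  {p | p ∈ S.homoclinic ∧ ∃ γu γs : ℝ → M, S.IsUnstableParam γu ∧ S.IsStableParam γs ∧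
    ∃ (a b : ℝ) (cu cs : Path S.x p), RunsAlong γu 0 a cu ∧ RunsAlong γs 0 b cs ∧
      (cu.trans cs.symm).Homotopic (Path.refl S.x)}

abbrev Point : Type u := S.contractible

/-! ### The Maslov index -/

/-- `θ` is an angle of the vector `e` in the basis `X`, `Y`. -/
def HasAngle (X Y e : Plane) (θ : ℝ) : Prop :=
  ∃ r : ℝ, 0 < r ∧ e = r • (Real.cos θ • X + Real.sin θ • Y)

/-- The relative Maslov index of `p` and `q` is `k`.

The segments `[p,q]_u` and `[p,q]_s` are joined by a homotopy `F` with fixed end points, and `X`, `Y`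
is a positively oriented frame along `F` that is constant on the two sides `F = p`, `F = q` of the
square. In this frame `θu`, `θs` are continuous angles of the tangents of the two segments.
Consider the loop of lines that follows the tangent of `[p,q]_u` from `p` to `q`, turns
counterclockwise at `q` by an angle in `(0,π)` to the tangent of the stable manifold, follows it
along `[p,q]_s` back to `p`, and turns clockwise at `p` by an angle in `(0,π)` to the tangent of the
unstable manifold. Since a counterclockwise turn by an angle in `(0,π)` from the line of angle
`θu` to the line of angle `θs` is the turn by `θs - θu - π * ⌊(θs - θu) / π⌋`, the total
rotation of this loop is `π` times the difference of floors below; that is, this difference is twice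
the winding number. -/
def HasMaslovIndex (p q : M) (k : ℤ) : Prop :=
  ∃ (γu γs : ℝ → M) (a b c d : ℝ) (cu cs : Path p q) (F : Path.Homotopy cu cs)
    (X Y : I × I → Plane) (θu θs : C(I, ℝ)),
    S.IsUnstableParam γu ∧ S.IsStableParam γs ∧ RunsAlong γu a b cu ∧ RunsAlong γs c d cs ∧
    Continuous (fun z => (⟨F z, X z⟩ : TangentBundle (𝓡 2) M)) ∧
    Continuous (fun z => (⟨F z, Y z⟩ : TangentBundle (𝓡 2) M)) ∧
    (∀ z, 0 < S.area.form (F z) (X z) (Y z)) ∧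
    (∀ s, X (s, 0) = X (0, 0) ∧ Y (s, 0) = Y (0, 0)) ∧
    (∀ s, X (s, 1) = X (0, 1) ∧ Y (s, 1) = Y (0, 1)) ∧
    (∀ t : I, HasAngle (X (0, t)) (Y (0, t))
      (velocity γu (AffineMap.lineMap a b (t : ℝ))) (θu t)) ∧
    (∀ t : I, HasAngle (X (1, t)) (Y (1, t))
      (velocity γs (AffineMap.lineMap c d (t : ℝ))) (θs t)) ∧
    k = ⌊(θs 0 - θu 0) / Real.pi⌋ - ⌊(θs 1 - θu 1) / Real.pi⌋

open Classical in
/-- The Maslov grading `μ(p) = μ(p, x)` of the contractible homoclinic points. (The index exists and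
is unique; the value `0` in the other case is never used.) -/
def μ (p : S.Point) : ℤ :=
  if h : ∃ k, S.HasMaslovIndex p S.x k then h.choose else 0

/-! ### Immersed di-gons and signs -/

/-- The di-gon: a closed lens with the two convex vertices `(-1,0)` and `(1,0)`. -/
def digon : Set Plane := {z | |z 1| ≤ 1 - z 0 ^ 2}

/-- The upper boundary `B_s`. -/
def upperBoundary : Set Plane := {z | z ∈ digon ∧ z 1 = 1 - z 0 ^ 2}

/-- The lower boundary `B_u`. -/
def lowerBoundary : Set Plane := {z | z ∈ digon ∧ z 1 = -(1 - z 0 ^ 2)}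

/-- The smooth orientation preserving immersed di-gons from `p` to `q`. Smoothness and immersivity
include the boundary and the vertices: a smooth extension to an open neighbourhood exists.
Dividing by reparametrizations gives the unparametrized di-gons, so one space is
empty exactly if the other is. -/
def immersedDigons (p q : M) : Set (digon → M) :=
  {f | ∃ (V : Plane → M) (U : Set Plane), IsOpen U ∧ digon ⊆ U ∧
    ContMDiffOn (𝓡 2) (𝓡 2) ∞ V U ∧ (∀ z : digon, f z = V z) ∧
    (∀ z ∈ digon, 0 < S.area.form (V z)
      (mfderiv (𝓡 2) (𝓡 2) V z (!₂[1, 0] : Plane)) (mfderiv (𝓡 2) (𝓡 2) V z (!₂[0, 1] : Plane))) ∧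
    (∀ z ∈ lowerBoundary, V z ∈ S.unstable) ∧ (∀ z ∈ upperBoundary, V z ∈ S.stable) ∧
    V !₂[-1, 0] = p ∧ V !₂[1, 0] = q}

/-- The direction from `p` to `q` along the unstable manifold agrees with its orientation. -/
def PointsForward (p q : M) : Prop :=
  ∃ γ : ℝ → M, S.IsOrientedUnstableParam γ ∧ ∃ a b : ℝ, a < b ∧ γ a = p ∧ γ b = q

open Classical in
/-- The sign `n(p,q)` of two points of relative Maslov index one. -/
def n (p q : S.Point) : ℤ :=
  if (S.immersedDigons p q).Nonempty then (if S.PointsForward p q then 1 else -1) else 0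

/-! ### Chain groups, boundary operators, local homology -/

/-- The elements of `E` of degree `k`. -/
def degreePart (E : Finset S.Point) (k : ℤ) : Finset S.Point := E.filter fun p => S.μ p = k

/-- The chain group `C_k(E) = ℤ E_k`. -/
abbrev Chain (E : Finset S.Point) (k : ℤ) : Type u := S.degreePart E k →₀ ℤ

/-- The boundary operator from degree `i` to degree `j = i - 1`, `p ↦ ∑ q, n(p,q) q`. -/
def boundary (E : Finset S.Point) (i j : ℤ) (_ : j + 1 = i) : S.Chain E i →ₗ[ℤ] S.Chain E j :=
  Finsupp.linearCombination ℤ fun p : S.degreePart E i =>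
    ∑ q : S.degreePart E j, Finsupp.single q (S.n p q)

/-- `∂`-completeness: `∂ ∘ ∂ = 0`. -/
def Complete (E : Finset S.Point) : Prop :=
  ∀ (i j k : ℤ) (hij : j + 1 = i) (hjk : k + 1 = j),
    S.boundary E j k hjk ∘ₗ S.boundary E i j hij = 0

variable {S} in
lemma degreePart_mono {D E : Finset S.Point} (h : D ≤ E) {k : ℤ} {p : S.Point}
    (hp : p ∈ S.degreePart D k) : p ∈ S.degreePart E k :=
  Finset.mem_filter.2 ⟨h (Finset.mem_filter.1 hp).1, (Finset.mem_filter.1 hp).2⟩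

/-- The inclusion `ℤ D_k → ℤ E_k`. -/
def incl {D E : Finset S.Point} (h : D ≤ E) (k : ℤ) : S.Chain D k →ₗ[ℤ] S.Chain E k :=
  Finsupp.lmapDomain ℤ ℤ fun p : S.degreePart D k => ⟨p.1, degreePart_mono h p.2⟩

/-- The pair `D ⊆ E` is chain compatible: the inclusion is a chain map. -/
def PairCompatible {D E : Finset S.Point} (h : D ≤ E) : Prop :=
  ∀ (i j : ℤ) (hij : j + 1 = i),
    S.incl h j ∘ₗ S.boundary D i j hij = S.boundary E i j hij ∘ₗ S.incl h i

/-- A chain compatible family of `∂`-complete finite sets. -/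
structure ChainCompatible (𝓕 : Set (Finset S.Point)) : Prop where
  complete : ∀ E ∈ 𝓕, S.Complete E
  pair : ∀ D ∈ 𝓕, ∀ E ∈ 𝓕, ∀ h : D ≤ E, S.PairCompatible h

/-- `ker ∂_k`. -/
def ker (E : Finset S.Point) (k : ℤ) : Submodule ℤ (S.Chain E k) :=
  LinearMap.ker (S.boundary E k (k - 1) (sub_add_cancel k 1))

/-- `Img ∂_{k+1}`, a subgroup of `C_k(E)`. -/
def img (E : Finset S.Point) (k : ℤ) : Submodule ℤ (S.Chain E k) :=
  LinearMap.range (S.boundary E (k + 1) k rfl)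

/-- The local Floer homology `H_k(E) = ker ∂_k / Img ∂_{k+1}`. -/
abbrev H (E : Finset S.Point) (k : ℤ) : Type u :=
  S.ker E k ⧸ (S.img E k).submoduleOf (S.ker E k)

variable {S}

lemma Complete.img_le_ker {E : Finset S.Point} (hE : S.Complete E) (k : ℤ) :
    S.img E k ≤ S.ker E k := by
  rintro _ ⟨c, rfl⟩
  exact LinearMap.congr_fun (hE (k + 1) k (k - 1) rfl (sub_add_cancel k 1)) c

lemma PairCompatible.incl_mem_ker {D E : Finset S.Point} {h : D ≤ E} (hc : S.PairCompatible h)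
    (k : ℤ) : ∀ c ∈ S.ker D k, S.incl h k c ∈ S.ker E k := by
  intro c hc'
  have h1 := LinearMap.congr_fun (hc k (k - 1) (sub_add_cancel k 1)) c
  have h2 : S.boundary D k (k - 1) (sub_add_cancel k 1) c = 0 := hc'
  simp only [LinearMap.comp_apply, h2, map_zero] at h1
  exact h1.symm

lemma PairCompatible.incl_mem_img {D E : Finset S.Point} {h : D ≤ E} (hc : S.PairCompatible h)
    (k : ℤ) : ∀ c ∈ S.img D k, S.incl h k c ∈ S.img E k := by
  rintro _ ⟨c, rfl⟩
  exact ⟨S.incl h (k + 1) c, (LinearMap.congr_fun (hc (k + 1) k rfl) c).symm⟩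

/-- The inclusion restricted to kernels. -/
def PairCompatible.kerMap {D E : Finset S.Point} {h : D ≤ E} (hc : S.PairCompatible h) (k : ℤ) :
    S.ker D k →ₗ[ℤ] S.ker E k :=
  (S.incl h k).restrict (hc.incl_mem_ker k)

/-- The inclusion restricted to images. -/
def PairCompatible.imgMap {D E : Finset S.Point} {h : D ≤ E} (hc : S.PairCompatible h) (k : ℤ) :
    S.img D k →ₗ[ℤ] S.img E k :=
  (S.incl h k).restrict (hc.incl_mem_img k)

/-- The map `H_k(D) → H_k(E)` induced by the inclusion. -/
def PairCompatible.homologyMap {D E : Finset S.Point} {h : D ≤ E} (hc : S.PairCompatible h)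
    (k : ℤ) : S.H D k →ₗ[ℤ] S.H E k :=
  Submodule.mapQ _ _ (hc.kerMap k) fun c hc' => hc.incl_mem_img k c.1 hc'

/-! ### The systems over a chain compatible family -/

namespace ChainCompatible

variable {𝓕 : Set (Finset S.Point)} (h𝓕 : S.ChainCompatible 𝓕)

/-- The groups `ker ∂_k^E`, `E ∈ 𝓕`, with the inclusions. -/
def kerSystem (k : ℤ) : SystemData 𝓕 where
  obj E := S.ker E.1 k
  map D E h := (h𝓕.pair D.1 D.2 E.1 E.2 h).kerMap k

/-- The groups `Img ∂_{k+1}^E`, `E ∈ 𝓕`, with the inclusions. -/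
def imgSystem (k : ℤ) : SystemData 𝓕 where
  obj E := S.img E.1 k
  map D E h := (h𝓕.pair D.1 D.2 E.1 E.2 h).imgMap k

/-- The groups `H_k(E)`, `E ∈ 𝓕`, with the maps induced by the inclusions. -/
def homologySystem (k : ℤ) : SystemData 𝓕 where
  obj E := S.H E.1 k
  map D E h := (h𝓕.pair D.1 D.2 E.1 E.2 h).homologyMap k

/-- The inclusions `Img ∂_{k+1}^E → ker ∂_k^E`. -/
def imgToKer (k : ℤ) : SystemData.Hom (h𝓕.imgSystem k) (h𝓕.kerSystem k) where
  app E := Submodule.inclusion ((h𝓕.complete E.1 E.2).img_le_ker k)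
  comm _ _ _ := rfl

/-- The projections `ker ∂_k^E → H_k(E)`. -/
def kerToHomology (k : ℤ) : SystemData.Hom (h𝓕.kerSystem k) (h𝓕.homologySystem k) where
  app E := ((S.img E.1 k).submoduleOf (S.ker E.1 k)).mkQ
  comm _ _ _ := rfl

/-- The system of the total homology groups `H(E) = ⨁ k, H_k(E)`. -/
def totalHomologySystem : SystemData 𝓕 := SystemData.directSum h𝓕.homologySystem

/-- `H_k` of the family: the direct limit of the groups `H_k(E)`. -/
abbrev limitHomology (k : ℤ) : Type u := (h𝓕.homologySystem k).lim

/-- The homology of the family: the direct sum of the direct limits. -/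
abbrev totalLimitHomology : Type u := DirectSum ℤ fun k => h𝓕.limitHomology k

/-- The canonical degreewise map of `H(E)` to the homology of the family. -/
def toTotalLimitHomology (E : 𝓕) :
    h𝓕.totalHomologySystem.obj E →ₗ[ℤ] h𝓕.totalLimitHomology :=
  DirectSum.lmap fun k => (h𝓕.homologySystem k).toLim E

end ChainCompatible

end Tangle

end HomoclinicFloer

end

open HomoclinicFloer

universe u w

namespace HomoclinicFloer

universe v w'

/-! ### Direct limits over a preorder -/

namespace SystemData

variable {ι : Type v} [Preorder ι]

/-! The geometry enters only through two algebraic facts: `∂ ∘ ∂ = 0` on each member of the family,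
and the inclusions are chain maps. Inclusions of free groups compose strictly, so cycles and
boundaries inherit the laws of a direct system, and homology inherits them as a quotient. The limit,
a quotient of the direct sum, is a colimit over any preorder (`isDirectLimit_lim`).

Directedness provides two facts: over a nonempty index every element of the limit comes from a
single stage (`exists_toLim`), and an element that dies in the limit already dies at a later stage
(`exists_map_eq_zero`). Exactness of limits (`limitsPreserveShortExact`) is then a diagram chase at
a sufficiently late stage. Applied to boundaries, cycles and homology it gives the sequence in each
degree, and the quotient description follows by the first isomorphism theorem.

For the total modules, direct sums preserve stagewise exactness, and the universal properties show
that they commute with direct limits (`IsDirectLimit.directSum`). -/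

lemma toLim_map (A : SystemData ι) {i j : ι} (h : i ≤ j) (x : A.obj i) :
    A.toLim j (A.map i j h x) = A.toLim i x := by
  classical
  exact Module.DirectLimit.of_f

lemma Hom.lim_toLim {A B : SystemData ι} (g : Hom A B) (i : ι) (x : A.obj i) :
    g.lim (A.toLim i x) = B.toLim i (g.app i x) := by
  classical
  exact Module.DirectLimit.map_apply_of g.app g.comm x

lemma exists_toLim [Nonempty ι] [IsDirectedOrder ι] (A : SystemData ι) (z : A.lim) :
    ∃ i x, A.toLim i x = z := by
  classical
  exact Module.DirectLimit.exists_of z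

/-- The quotient `lim` makes sense without the laws of a direct system; detecting zero at a finite
stage is where they are needed. -/
lemma IsDirectSystem.exists_map_eq_zero [IsDirectedOrder ι] {A : SystemData ι}
    (hA : A.IsDirectSystem) {i : ι} {x : A.obj i} (hx : A.toLim i x = 0) :
    ∃ j, ∃ h : i ≤ j, A.map i j h x = 0 := by
  classical
  have : DirectedSystem A.obj (fun i j h => A.map i j h) :=
    ⟨fun i x => LinearMap.congr_fun (hA.1 i le_rfl) x,
      fun _ _ _ hij hjk x => LinearMap.congr_fun (hA.2 _ _ _ hij hjk) x⟩
  exact Module.DirectLimit.of.zero_exact hx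

/-- The direct limit has the universal property of the colimit, for any index preorder. -/
lemma isDirectLimit_lim (A : SystemData.{v, w} ι) :
    IsDirectLimit.{v, w, w'} A A.lim A.toLim := by
  classical
  refine ⟨fun i j h => LinearMap.ext fun x => A.toLim_map h x, fun T _ g hg => ?_⟩
  have hg' (i j : ι) (h : i ≤ j) (x : A.obj i) : g j (A.map i j h x) = g i x :=
    LinearMap.congr_fun (hg i j h) x
  have hlift (i : ι) : Module.DirectLimit.lift ℤ ι A.obj A.map g hg' ∘ₗ A.toLim i = g i :=
    LinearMap.ext fun x => Module.DirectLimit.lift_of g hg' x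
  exact ⟨_, hlift, fun θ hθ => Module.DirectLimit.hom_ext fun i =>
    (hθ i).trans (hlift i).symm⟩

/-- With no stages, any two maps out of the limit agree by uniqueness, in particular the identity
and zero. -/
lemma subsingleton_lim [IsEmpty ι] (A : SystemData ι) : Subsingleton A.lim := by
  have hid : (LinearMap.id : A.lim →ₗ[ℤ] A.lim) = 0 :=
    (A.isDirectLimit_lim.2 A.lim A.toLim isEmptyElim).unique isEmptyElim isEmptyElim
  exact subsingleton_of_forall_eq 0 (LinearMap.congr_fun hid)

lemma limitsPreserveShortExact [IsDirectedOrder ι] : LimitsPreserveShortExact ι := by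
  intro A B C g h _ hB hC hex
  -- A directed order may be empty, and then elements of the limit have no representatives at a
  -- stage; all three limits vanish.
  cases isEmpty_or_nonempty ι
  · have := A.subsingleton_lim
    have := B.subsingleton_lim
    have := C.subsingleton_lim
    exact ⟨Function.injective_of_subsingleton _, Subsingleton.elim _ _,
      Function.surjective_to_subsingleton _⟩
  refine ⟨(injective_iff_map_eq_zero _).2 fun z hz => ?_, le_antisymm ?_ ?_, fun z => ?_⟩
  · obtain ⟨i, x, rfl⟩ := A.exists_toLim z
    rw [Hom.lim_toLim] at hz
    -- The image of `x` need not vanish at stage `i`, only at some later `j`; injectivity is used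
    -- there.
    obtain ⟨j, hij, hj⟩ := hB.exists_map_eq_zero hz
    have hgx : g.app j (A.map i j hij x) = 0 := (LinearMap.congr_fun (g.comm i j hij) x).trans hj
    rw [← A.toLim_map hij, (injective_iff_map_eq_zero _).1 (hex j).1 _ hgx, map_zero]
  · rintro _ ⟨z, rfl⟩
    obtain ⟨i, x, rfl⟩ := A.exists_toLim z
    have hx : h.app i (g.app i x) = 0 := (hex i).2.1.le ⟨x, rfl⟩
    rw [LinearMap.mem_ker, Hom.lim_toLim, Hom.lim_toLim, hx, map_zero]
  · intro z hz
    obtain ⟨i, y, rfl⟩ := B.exists_toLim z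
    rw [LinearMap.mem_ker, Hom.lim_toLim] at hz
    obtain ⟨j, hij, hj⟩ := hC.exists_map_eq_zero hz
    have hhy : h.app j (B.map i j hij y) = 0 := (LinearMap.congr_fun (h.comm i j hij) y).trans hj
    -- At stage `j` the representative has become a cycle for `h`, so exactness there supplies a
    -- preimage.
    obtain ⟨x, hx⟩ := (hex j).2.1.ge hhy
    exact ⟨A.toLim j x, by rw [Hom.lim_toLim, hx, B.toLim_map]⟩
  · obtain ⟨i, y, rfl⟩ := C.exists_toLim z
    obtain ⟨x, rfl⟩ := (hex i).2.2 y
    exact ⟨B.toLim i x, Hom.lim_toLim h i x⟩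

/-- The first isomorphism theorem for `h`, inverted, with its kernel replaced by the range of `g`.
-/
lemma IsShortExact.exists_equiv_quotient {A B C : Type*} [AddCommGroup A] [AddCommGroup B]
    [AddCommGroup C] {g : A →ₗ[ℤ] B} {h : B →ₗ[ℤ] C} (hex : IsShortExact g h) :
    ∃ e : C ≃ₗ[ℤ] B ⧸ LinearMap.range g, ∀ z, e (h z) = Submodule.Quotient.mk z := by
  refine ⟨((Submodule.quotEquivOfEq _ _ hex.2.1).trans
    (h.quotKerEquivOfSurjective hex.2.2)).symm, fun z => ?_⟩
  rw [LinearEquiv.symm_apply_eq]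
  rfl

/-! ### Direct sums of systems, exact sequences and limits -/

section DirectSum

variable {K : Type}

lemma IsDirectSystem.directSum {A : K → SystemData ι} (hA : ∀ k, (A k).IsDirectSystem) :
    (SystemData.directSum A).IsDirectSystem := by
  refine ⟨fun i h => LinearMap.ext fun x => DFinsupp.ext fun k => ?_,
    fun i j l hij hjl => LinearMap.ext fun x => DFinsupp.ext fun k => ?_⟩
  · exact LinearMap.congr_fun ((hA k).1 i h) ((show DirectSum K fun k => (A k).obj i from x) k)
  · exact LinearMap.congr_fun ((hA k).2 i j l hij hjl)
      ((show DirectSum K fun k => (A k).obj i from x) k)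

lemma IsShortExact.directSum {A B C : K → Type*} [∀ k, AddCommGroup (A k)]
    [∀ k, AddCommGroup (B k)] [∀ k, AddCommGroup (C k)] {g : ∀ k, A k →ₗ[ℤ] B k}
    {h : ∀ k, B k →ₗ[ℤ] C k} (hex : ∀ k, IsShortExact (g k) (h k)) :
    IsShortExact (DirectSum.lmap g) (DirectSum.lmap h) := by
  classical
  refine ⟨(DirectSum.lmap_injective g).2 fun k => (hex k).1, ?_,
    (DirectSum.lmap_surjective h).2 fun k => (hex k).2.2⟩
  rw [DirectSum.range_lmap, DirectSum.ker_lmap]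
  simp only [(hex _).2.1]

/-- Direct sums of direct limits are direct limits of direct sums. -/
lemma IsDirectLimit.directSum {A : K → SystemData.{v, w} ι} {L : K → Type*} [∀ k, AddCommGroup (L k)]
    {c : ∀ k i, (A k).obj i →ₗ[ℤ] L k}
    (hc : ∀ k, IsDirectLimit.{v, w, w'} (A k) (L k) (c k)) :
    IsDirectLimit.{v, w, w'} (SystemData.directSum A) (DirectSum K L)
      (fun i => DirectSum.lmap fun k => c k i) := by
  classical
  refine ⟨fun i j h => LinearMap.ext fun x => DFinsupp.ext fun k => ?_, fun T _ g hg => ?_⟩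
  · exact LinearMap.congr_fun ((hc k).1 i j h)
      ((show DirectSum K fun k => (A k).obj i from x) k)
  -- Restricting a cocone on the direct sum to the `k`-th summand gives a cocone on `A k`, which
  -- factors through `L k`.
  have hcocone (k : K) (i j : ι) (h : i ≤ j) :
      (g j ∘ₗ DirectSum.lof ℤ K (fun k => (A k).obj j) k) ∘ₗ (A k).map i j h =
        g i ∘ₗ DirectSum.lof ℤ K (fun k => (A k).obj i) k := by
    refine LinearMap.ext fun x => ?_
    have h1 := LinearMap.congr_fun (hg i j h) (DirectSum.lof ℤ K (fun k => (A k).obj i) k x)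
    refine Eq.trans (congrArg (g j) ?_) h1
    exact (DirectSum.lmap_lof (fun k => (A k).map i j h) k x).symm
  choose θ hθ hθ_unique using fun k => (hc k).2 T _ (hcocone k)
  refine ⟨DirectSum.toModule ℤ K T θ, fun i => ?_, fun η hη => ?_⟩
  · refine DirectSum.linearMap_ext ℤ fun k => LinearMap.ext fun x => ?_
    refine (congrArg (DirectSum.toModule ℤ K T θ)
      (DirectSum.lmap_lof (fun k => c k i) k x)).trans ?_
    exact (DirectSum.toModule_lof ℤ k _).trans (LinearMap.congr_fun (hθ k i) x)
  -- A map out of a direct sum is determined on the summands, where uniqueness of `θ k` applies.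
  · refine DirectSum.linearMap_ext ℤ fun k => ?_
    rw [show DirectSum.toModule ℤ K T θ ∘ₗ DirectSum.lof ℤ K L k = θ k from
      LinearMap.ext fun x => DirectSum.toModule_lof ℤ k x]
    refine hθ_unique k _ fun i => LinearMap.ext fun x => ?_
    rw [← hη i]
    exact congrArg η (DirectSum.lmap_lof (fun k => c k i) k x).symm

end DirectSum

end SystemData

/-! ### Cycles, boundaries and homology of a chain compatible family -/

namespace Tangle

variable {M : Type*} [TopologicalSpace M] [ChartedSpace Plane M] [IsManifold (𝓡 2) ∞ M]
  {S : Tangle M}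

lemma incl_refl {E : Finset S.Point} (h : E ≤ E) (k : ℤ) : S.incl h k = LinearMap.id :=
  Finsupp.lmapDomain_id ℤ ℤ

lemma incl_incl {C D E : Finset S.Point} (hCD : C ≤ D) (hDE : D ≤ E) (k : ℤ)
    (c : S.Chain C k) : S.incl hDE k (S.incl hCD k c) = S.incl (hCD.trans hDE) k c :=
  Finsupp.mapDomain_comp.symm

namespace ChainCompatible

variable {𝓕 : Set (Finset S.Point)} (h𝓕 : S.ChainCompatible 𝓕)

lemma isDirectSystem_kerSystem (k : ℤ) : (h𝓕.kerSystem k).IsDirectSystem :=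
  ⟨fun _ h => LinearMap.ext fun c => Subtype.ext (LinearMap.congr_fun (incl_refl h k) c.1),
    fun _ _ _ hCD hDE => LinearMap.ext fun c => Subtype.ext (incl_incl hCD hDE k c.1)⟩

lemma isDirectSystem_imgSystem (k : ℤ) : (h𝓕.imgSystem k).IsDirectSystem :=
  ⟨fun _ h => LinearMap.ext fun c => Subtype.ext (LinearMap.congr_fun (incl_refl h k) c.1),
    fun _ _ _ hCD hDE => LinearMap.ext fun c => Subtype.ext (incl_incl hCD hDE k c.1)⟩

/-- Maps out of a quotient agree once they agree on cycles, and there the laws are those of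
`kerSystem`. -/
lemma isDirectSystem_homologySystem (k : ℤ) : (h𝓕.homologySystem k).IsDirectSystem := by
  refine ⟨fun E h => Submodule.linearMap_qext _ (LinearMap.ext fun c => ?_),
    fun C D E hCD hDE => Submodule.linearMap_qext _ (LinearMap.ext fun c => ?_)⟩
  · exact congrArg (Submodule.Quotient.mk (p := (S.img E.1 k).submoduleOf (S.ker E.1 k)))
      (LinearMap.congr_fun ((h𝓕.isDirectSystem_kerSystem k).1 E h) c)
  · exact congrArg (Submodule.Quotient.mk (p := (S.img E.1 k).submoduleOf (S.ker E.1 k)))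
      (LinearMap.congr_fun ((h𝓕.isDirectSystem_kerSystem k).2 C D E hCD hDE) c)

lemma isShortExact_app (k : ℤ) (E : 𝓕) :
    SystemData.IsShortExact ((h𝓕.imgToKer k).app E) ((h𝓕.kerToHomology k).app E) := by
  refine ⟨Submodule.inclusion_injective ((h𝓕.complete E.1 E.2).img_le_ker k), ?_, Submodule.mkQ_surjective _⟩
  -- Both submodules are the boundaries viewed inside the cycles, exactly what `H` divides by.
  exact (Submodule.range_inclusion _ _ ((h𝓕.complete E.1 E.2).img_le_ker k)).trans (Submodule.ker_mkQ _).symm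

end ChainCompatible

end Tangle

end HomoclinicFloer

theorem mainTheorem1 {M : Type u} [TopologicalSpace M] [T2Space M]
    [SecondCountableTopology M] [ChartedSpace Plane M] [IsManifold (𝓡 2) ∞ M]
    (S : Tangle M) (𝓕 : Set (Finset S.Point)) (h𝓕 : S.ChainCompatible 𝓕) :
    -- the homology groups form direct systems, in each degree and in total
    (∀ k, (h𝓕.homologySystem k).IsDirectSystem) ∧
    h𝓕.totalHomologySystem.IsDirectSystem ∧
    -- the total transition maps preserve the grading
    (∀ (D E : 𝓕) (h : D ≤ E) (k : ℤ) (z : S.H D.1 k),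
      h𝓕.totalHomologySystem.map D E h (DirectSum.of (fun k => S.H D.1 k) k z) =
        DirectSum.of (fun k => S.H E.1 k) k ((h𝓕.homologySystem k).map D E h z)) ∧
    -- so do the kernels and the images
    (∀ k, (h𝓕.kerSystem k).IsDirectSystem ∧ (h𝓕.imgSystem k).IsDirectSystem) ∧
    -- direct limits exist
    (∀ k, SystemData.IsDirectLimit.{u, u, w} (h𝓕.homologySystem k) (h𝓕.limitHomology k)
      (h𝓕.homologySystem k).toLim) ∧
    SystemData.IsDirectLimit.{u, u, w} h𝓕.totalHomologySystem h𝓕.totalHomologySystem.lim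
      h𝓕.totalHomologySystem.toLim ∧
    -- if the family is directed
    (IsDirectedOrder 𝓕 →
      -- direct limits over the family are compatible with short exact sequences
      SystemData.LimitsPreserveShortExact.{u, w} 𝓕 ∧
      (∀ k, SystemData.IsShortExact (h𝓕.imgToKer k).lim (h𝓕.kerToHomology k).lim) ∧
      SystemData.IsShortExact (SystemData.Hom.directSum h𝓕.imgToKer).lim
        (SystemData.Hom.directSum h𝓕.kerToHomology).lim ∧
      -- `lim H_k` is the quotient of `lim ker` by `lim Img`
      (∀ k, ∃ e : h𝓕.limitHomology k ≃ₗ[ℤ]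
          ((h𝓕.kerSystem k).lim ⧸ LinearMap.range (h𝓕.imgToKer k).lim),
        ∀ z, e ((h𝓕.kerToHomology k).lim z) = Submodule.Quotient.mk z) ∧
      -- the direct sum of the groups `lim H_k` is the direct limit of the total homologies
      SystemData.IsDirectLimit.{u, u, w} h𝓕.totalHomologySystem h𝓕.totalLimitHomology
        h𝓕.toTotalLimitHomology) := by
  have hshort (k : ℤ) (h : IsDirectedOrder 𝓕) :
      SystemData.IsShortExact (h𝓕.imgToKer k).lim (h𝓕.kerToHomology k).lim :=
    SystemData.limitsPreserveShortExact _ _ _ _ _ (h𝓕.isDirectSystem_imgSystem k)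
      (h𝓕.isDirectSystem_kerSystem k) (h𝓕.isDirectSystem_homologySystem k)
      (h𝓕.isShortExact_app k)
  refine ⟨h𝓕.isDirectSystem_homologySystem, .directSum h𝓕.isDirectSystem_homologySystem,
    fun D E h k z => DirectSum.lmap_of (fun k => (h𝓕.homologySystem k).map D E h) k z,
    fun k => ⟨h𝓕.isDirectSystem_kerSystem k, h𝓕.isDirectSystem_imgSystem k⟩,
    fun k => SystemData.isDirectLimit_lim _, SystemData.isDirectLimit_lim _, fun h => ?_⟩
  refine ⟨SystemData.limitsPreserveShortExact, fun k => hshort k h, ?_,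
    fun k => (hshort k h).exists_equiv_quotient,
    .directSum fun k => SystemData.isDirectLimit_lim _⟩
  -- The sum over degrees is taken at each stage before passing to the limit, so exactness of limits
  -- applies directly to the total systems.
  exact SystemData.limitsPreserveShortExact _ _ _ _ _ (.directSum h𝓕.isDirectSystem_imgSystem)
    (.directSum h𝓕.isDirectSystem_kerSystem) (.directSum h𝓕.isDirectSystem_homologySystem)
    fun E => .directSum fun k => h𝓕.isShortExact_app k E
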